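/- Let $\theta^*\approx 0.2938\ldots$ be the unique positive solution of $(1+\theta)\log(1+\theta)-\theta\log\theta=\log 2$, and let $b$ be a fixed non-negative integer. For each $i\in[n]$ let the costs $(C(i,j))_{j\in[n]\setminus\{i\}}$ of the edges leaving vertex $i$ in the complete loopless digraph $\vec K_n$ be a uniformly random arrangement of $1,2,\ldots,n-1$, independently for different $i$. Maker and Breaker, who both know $C$, play the following game on the edges of $\vec K_n$: in each round Maker takes one edge that has been neither taken nor deleted, and then Breaker deletes $b$ edges not taken by Maker (fewer are also allowed). Call a set $T$ of edges a spanning arborescence if it consists of the edges of a spanning tree of the complete graph on $[n]$, each oriented towards one common vertex, the root (so every vertex has out-degree at most one), and let $C(T)=\sum_{(i,j)\in T}C(i,j)$. Then there is a sequence $\delta_n\to 0$, which may depend on $b$, such that, with probability tending to $1$ as $n\to\infty$ over the choice of $C$, Maker has a strategy which guarantees, whatever Breaker does, that the $n-1$ edges she takes in the first $n-1$ rounds form a spanning arborescence $T$ with $$C(T)\le\left(\frac{b}{\theta^*}+b+1+\delta_n\right)n .$$ -/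

import Mathlib

namespace WeightedTreeGame

/-- The board: the edges `(i, j)`, `i ≠ j`, of the complete loopless digraph on `Fin n`. -/
abbrev Edge (n : ℕ) : Type := {e : Fin n × Fin n // e.1 ≠ e.2}

/-- The possible cost rows of vertex `i`: bijections from the other vertices onto an
`(n - 1)`-element set.  The value `k : Fin (n - 1)` stands for the cost `k + 1 ∈ {1, …, n - 1}`. -/
abbrev Row (n : ℕ) (i : Fin n) : Type := {j : Fin n // j ≠ i} ≃ Fin (n - 1)

instance (n : ℕ) (i : Fin n) : MeasurableSpace (Row n i) := ⊤

/-- A cost matrix (off the diagonal; the board has no loops). -/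
abbrev Costs (n : ℕ) : Type := (i : Fin n) → Row n i

/-- The law of the random cost matrix: independent rows, each uniform over all bijections. -/
noncomputable def costLaw (n : ℕ) : MeasureTheory.Measure (Costs n) :=
  MeasureTheory.Measure.pi fun _ => ProbabilityTheory.uniformOn Set.univ

/-- The cost `C(i, j) ∈ {1, …, n - 1}` of the edge `(i, j)`. -/
def cost {n : ℕ} (C : Costs n) (e : Edge n) : ℕ :=
  (C e.1.1 ⟨e.1.2, e.2.symm⟩ : ℕ) + 1

/-- `Arc T i j`: the edge set `T` contains the edge directed from `i` to `j`. -/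
def Arc {n : ℕ} (T : Finset (Edge n)) (i j : Fin n) : Prop :=
  ∃ e ∈ T, e.1 = (i, j)

/-- `T` is a spanning arborescence: forgetting the orientations gives a spanning tree, every
edge of the tree has exactly one orientation in `T`, and the edges are oriented towards one
vertex `r`, the root, i.e. `T` contains a directed path from every vertex to `r`.
(In particular every vertex has out-degree at most one.) -/
def IsSpanningArborescence {n : ℕ} (T : Finset (Edge n)) : Prop :=
  (SimpleGraph.fromRel (Arc T)).IsTree ∧
  (∀ i j, Arc T i j → ¬ Arc T j i) ∧
  ∃ r, ∀ v, Relation.ReflTransGen (Arc T) v r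

/-- `MakerForces b goal k M B`: from the position in which Maker holds the edges `M`, Breaker
has deleted the edges `B` and Maker is to move, Maker has a strategy such that, whatever Breaker
does, Maker's edge set satisfies `goal` after `k` further rounds.  In a round Maker takes an
edge that is neither taken nor deleted, and then Breaker deletes at most `b` edges that Maker has
not taken. -/
def MakerForces {n : ℕ} (b : ℕ) (goal : Finset (Edge n) → Prop) :
    ℕ → Finset (Edge n) → Finset (Edge n) → Prop
  | 0, M, _ => goal M
  | k + 1, M, B => ∃ e : Edge n, e ∉ M ∧ e ∉ B ∧
      ∀ D : Finset (Edge n), D.card ≤ b → Disjoint D (insert e M) →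
        MakerForces b goal k (insert e M) (B ∪ D)

/-- In the game with costs `C`, known to both players, Maker moving first and Breaker deleting
`b` edges per round, Maker can guarantee that her `n - 1` edges form a spanning arborescence of
total cost at most `L`. -/
def MakerCanAchieve {n : ℕ} (b : ℕ) (C : Costs n) (L : ℝ) : Prop :=
  MakerForces b
    (fun T => IsSpanningArborescence T ∧ ((∑ e ∈ T, cost C e : ℕ) : ℝ) ≤ L) (n - 1) ∅ ∅

end WeightedTreeGame

/-! Maker grows a forest oriented towards roots. In each round she picks a root `r` whose component
has at most n/2 vertices and takes the cheapest surviving edge from `r` to another component. Its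
cost is 1 plus the cheaper edges skipped. The 1's contribute at most n. A skipped edge leaving the
component was deleted by Breaker at `r`, and `r` is never a root again, so these edges number at
most bn in total.

The edges skipped inside components, W in number, are controlled by a union bound over all courses
of play, since Breaker adapts to `C`. `courseSum` adds up x^W z^D y^U over all courses (D outer
skips, U emergency moves). A row is read only when its vertex moves, so the mean is bounded by a
product of one-row means (`sum_equiv_sum_outside_le`, `sum_courseSum_le`). Usually the smallest
component moves: with many components left it rarely contains the skipped edges, and the factor is
close to 1/(1-z). An emergency move at a root with about n/4 deleted edges occurs at most 5b times,
and the choice y = n⁻² makes summing over its location cheap.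

By Markov, x^β z^b (1-z) > 1 gives W ≤ βn with probability tending to 1, hence cost at most (β+b+1)n
(`tendsto_costLaw_makerCanAchieve`). Explicit x and z allow β = b/θ* for b ≥ 1, and any β > 0 for b
= 0. -/

namespace WeightedTreeGame

open Finset Filter Topology

/-! ### Exponential moments in one uniformly random row. -/

section Row

variable {α : Type*} {m : ℕ}

/-- The product of the weights of the elements on the first `p` positions of the ordering `π`. -/
noncomputable def prefixProd (y : α → ℝ) (p : ℕ) (π : α ≃ Fin m) : ℝ :=
  ∏ i : Fin m, if (i : ℕ) < p then y (π.symm i) else 1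

theorem prefixProd_nonneg {y : α → ℝ} (hy : ∀ i, 0 ≤ y i) (p : ℕ) (π : α ≃ Fin m) :
    0 ≤ prefixProd y p π := by
  refine prod_nonneg fun i _ => ?_
  split_ifs
  exacts [hy _, zero_le_one]

theorem prefixProd_zero (y : α → ℝ) (π : α ≃ Fin m) : prefixProd y 0 π = 1 := by
  simp [prefixProd]

theorem prefixProd_succ (y : α → ℝ) (p : Fin m) (π : α ≃ Fin m) :
    prefixProd y (p + 1) π = prefixProd y p π * y (π.symm p) := by
  have h : y (π.symm p) = ∏ i : Fin m, if i = p then y (π.symm i) else 1 := by simp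
  rw [h, prefixProd, prefixProd, ← prod_mul_distrib]
  refine prod_congr rfl fun i _ => ?_
  rcases lt_trichotomy (i : ℕ) p with hlt | heq | hgt
  · have : i ≠ p := fun h => by simp [h] at hlt
    simp [hlt, this, Nat.lt_succ_of_lt hlt]
  · have : i = p := Fin.ext heq
    subst this
    simp
  · have : i ≠ p := fun h => by simp [h] at hgt
    simp [this, show ¬ (i : ℕ) < p + 1 by omega, show ¬ (i : ℕ) < p by omega]

theorem prefixProd_swap_of_le (y : α → ℝ) {p q : Fin m} (h : p ≤ q) (π : α ≃ Fin m) :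
    prefixProd y p (π.trans (Equiv.swap p q)) = prefixProd y p π := by
  refine prod_congr rfl fun i _ => ?_
  by_cases hi : (i : ℕ) < p
  · have h1 : i ≠ p := fun h => by simp [h] at hi
    have h2 : i ≠ q := fun h' => by subst h'; exact absurd hi (not_lt.2 h)
    simp [hi, Equiv.swap_apply_of_ne_of_ne h1 h2]
  · simp [hi]

/-- The part of `prefixProd` that avoids the position `q`. -/
noncomputable def prefixProdErase (y : α → ℝ) (p : ℕ) (q : Fin m) (π : α ≃ Fin m) : ℝ :=
  ∏ i : Fin m, if (i : ℕ) < p ∧ i ≠ q then y (π.symm i) else 1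

theorem prefixProdErase_nonneg {y : α → ℝ} (hy : ∀ i, 0 ≤ y i) (p : ℕ) (q : Fin m)
    (π : α ≃ Fin m) : 0 ≤ prefixProdErase y p q π := by
  refine prod_nonneg fun i _ => ?_
  split_ifs
  exacts [hy _, zero_le_one]

theorem prefixProd_eq_erase_mul (y : α → ℝ) {p : ℕ} {q : Fin m} (h : (q : ℕ) < p)
    (π : α ≃ Fin m) : prefixProd y p π = prefixProdErase y p q π * y (π.symm q) := by
  have h1 : y (π.symm q) = ∏ i : Fin m, if i = q then y (π.symm i) else 1 := by simp
  rw [h1, prefixProd, prefixProdErase, ← prod_mul_distrib]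
  refine prod_congr rfl fun i _ => ?_
  by_cases hi : i = q
  · subst hi; simp [h]
  · simp [hi]

theorem prefixProdErase_swap (y : α → ℝ) (p q : Fin m) (π : α ≃ Fin m) :
    prefixProdErase y p q (π.trans (Equiv.swap p q)) = prefixProdErase y p q π := by
  refine prod_congr rfl fun i _ => ?_
  by_cases hi : (i : ℕ) < p ∧ i ≠ q
  · have h1 : i ≠ p := fun h => by simp [h] at hi
    simp [hi, Equiv.swap_apply_of_ne_of_ne h1 hi.2]
  · rw [if_neg hi, if_neg hi]

variable [Fintype α]

theorem prod_ite_lt_eq_prefixProd (y : α → ℝ) (π : α ≃ Fin m) (q : Fin m) :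
    ∏ i, (if π i < q then y i else 1) = prefixProd y q π := by
  rw [prefixProd, ← Equiv.prod_comp π]
  refine prod_congr rfl fun i _ => ?_
  rw [Equiv.symm_apply_apply]
  rfl

variable [DecidableEq α]

theorem sum_trans_swap (f : (α ≃ Fin m) → ℝ) (p q : Fin m) :
    ∑ π : α ≃ Fin m, f (π.trans (Equiv.swap p q)) = ∑ π : α ≃ Fin m, f π := by
  have hinv : Function.Involutive fun π : α ≃ Fin m => π.trans (Equiv.swap p q) := by
    intro π
    ext i
    simp
  exact Fintype.sum_bijective _ hinv.bijective _ _ fun _ => rfl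

/-- Exchange positions `p` and `q` in the ordering. If `q` is not in the prefix, this gives
equality. Otherwise, after symmetrization, the claim is 2uv ≤ u² + v² for the two weights. -/
theorem sum_prefixProd_succ_le {y : α → ℝ} (hy : ∀ i, 0 ≤ y i) (p q : Fin m) :
    ∑ π : α ≃ Fin m, prefixProd y (p + 1) π
      ≤ ∑ π : α ≃ Fin m, prefixProd y p π * y (π.symm q) := by
  simp only [prefixProd_succ]
  rcases le_or_gt p q with h | h
  · rw [← sum_trans_swap _ p q]
    simp [prefixProd_swap_of_le y h]
  · have h' : (q : ℕ) < p := h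
    simp only [prefixProd_eq_erase_mul y h']
    set R : (α ≃ Fin m) → ℝ := fun π => prefixProdErase y p q π
    have h2 : ∑ π : α ≃ Fin m, R π * y (π.symm q) * y (π.symm q)
        = ∑ π : α ≃ Fin m, R π * y (π.symm p) * y (π.symm p) := by
      rw [← sum_trans_swap _ p q]
      simp [R, prefixProdErase_swap]
    have h3 : ∑ π : α ≃ Fin m, 2 * (R π * y (π.symm q) * y (π.symm p))
        ≤ ∑ π : α ≃ Fin m, (R π * y (π.symm q) * y (π.symm q)
          + R π * y (π.symm p) * y (π.symm p)) := by
      refine sum_le_sum fun π _ => ?_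
      nlinarith [mul_nonneg (prefixProdErase_nonneg hy p q π)
        (sq_nonneg (y (π.symm q) - y (π.symm p)))]
    rw [← mul_sum, sum_add_distrib, ← h2] at h3
    linarith

/-- Averaging over `q` replaces the next weight by the mean weight: sampling without replacement has
products no larger in mean than sampling with replacement. -/
theorem card_mul_sum_prefixProd_succ_le {y : α → ℝ} (hy : ∀ i, 0 ≤ y i) (p : Fin m) :
    m * ∑ π : α ≃ Fin m, prefixProd y (p + 1) π
      ≤ (∑ i, y i) * ∑ π : α ≃ Fin m, prefixProd y p π := by
  have h := sum_le_sum fun q (_ : q ∈ (univ : Finset (Fin m))) => sum_prefixProd_succ_le hy p q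
  rw [sum_const, card_univ, Fintype.card_fin, nsmul_eq_mul, sum_comm] at h
  refine h.trans_eq ?_
  rw [mul_sum]
  refine sum_congr rfl fun π _ => ?_
  rw [← mul_sum, Equiv.sum_comp π.symm y, mul_comm]

/-- In a uniformly random ordering, the sum over the elements `j` outside `A` of
`x ^ (number of elements of A before j) * z ^ (number of other elements before j)` has
expectation at most `c / ((1 - z) * c - (x - 1) * a)`, where `a = |A|` and `c = |Aᶜ|`. -/
theorem sum_equiv_sum_outside_le (A : Finset α) {x z : ℝ} (hz : 0 ≤ z) (hz1 : z < 1)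
    (hx : 1 ≤ x) (hm : Fintype.card α = m) (hpos : (x - 1) * #A < (1 - z) * #Aᶜ) :
    ∑ π : α ≃ Fin m, ∑ j ∈ Aᶜ, ∏ i, (if π i < π j then (if i ∈ A then x else z) else 1)
      ≤ (Fintype.card (α ≃ Fin m) : ℝ) * (#Aᶜ / ((1 - z) * #Aᶜ - (x - 1) * #A)) := by
  set y : α → ℝ := fun i => if i ∈ A then x else z with hy_def
  have hy : ∀ i, 0 ≤ y i := fun i => by simp only [y]; split_ifs <;> linarith
  have hcard : (#A : ℝ) + #Aᶜ = m := by
    rw [← hm]; exact_mod_cast card_add_card_compl A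
  have hysum : ∑ i, y i = x * #A + z * #Aᶜ := by
    rw [← sum_add_sum_compl A]
    congr 1
    · rw [sum_congr rfl fun i hi => show y i = x by simp [y, hi]]; simp [mul_comm]
    · rw [sum_congr rfl fun i hi => show y i = z by simp [y, mem_compl.1 hi]]; simp [mul_comm]
  set G : ℕ → ℝ := fun p => ∑ π : α ≃ Fin m, prefixProd y p π with hG
  have hG0 : G 0 = Fintype.card (α ≃ Fin m) := by simp [hG, prefixProd_zero]
  have hGm : 0 ≤ G m := sum_nonneg fun π _ => prefixProd_nonneg hy _ π
  have hstep : ∀ p ∈ range m, m * G (p + 1) ≤ (x * #A + z * #Aᶜ) * G p := fun p hp => by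
    rw [← hysum]
    exact card_mul_sum_prefixProd_succ_le hy ⟨p, mem_range.1 hp⟩
  have htel : ∑ p ∈ range m, G (p + 1) = ∑ p ∈ range m, G p + G m - G 0 := by
    have h1 := sum_range_succ G m
    have h2 := sum_range_succ' G m
    linarith
  set S := ∑ p ∈ range m, G p with hS
  have h1 := sum_le_sum hstep
  rw [← mul_sum, ← mul_sum, htel, ← hS] at h1
  -- The factor `x - y j` vanishes on `A` and equals `x - z` off `A`, so the sum over `j` outside
  -- `A` becomes a difference of consecutive prefix sums over all positions.
  have hL : (x - z) * ∑ π : α ≃ Fin m, ∑ j ∈ Aᶜ, ∏ i, (if π i < π j then y i else 1)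
      = x * S - ∑ p ∈ range m, G (p + 1) := by
    have e1 : ∀ π : α ≃ Fin m, (x - z) * ∑ j ∈ Aᶜ, ∏ i, (if π i < π j then y i else 1)
        = ∑ q : Fin m, (x * prefixProd y q π - prefixProd y (q + 1) π) := by
      intro π
      rw [← Equiv.sum_comp π, mul_sum, ← sum_add_sum_compl A]
      rw [sum_eq_zero (s := A), zero_add]
      · refine sum_congr rfl fun j hj => ?_
        rw [prod_ite_lt_eq_prefixProd, prefixProd_succ]
        simp [y, mem_compl.1 hj]
        ring
      · intro j hj
        rw [prefixProd_succ]
        simp [y, hj]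
        ring
    rw [mul_sum, sum_congr rfl fun π _ => e1 π, sum_comm]
    simp only [sum_sub_distrib, ← mul_sum]
    rw [hS, ← Fin.sum_univ_eq_sum_range, ← Fin.sum_univ_eq_sum_range]
  rw [htel, hG0] at hL
  rw [hG0] at h1
  set N := (Fintype.card (α ≃ Fin m) : ℝ)
  set a := (#A : ℝ)
  set c := (#Aᶜ : ℝ)
  set X := ∑ π : α ≃ Fin m, ∑ j ∈ Aᶜ, ∏ i, (if π i < π j then y i else 1) with hX
  have hQ : 0 < (1 - z) * c - (x - 1) * a := by linarith
  have hxz : 0 < x - z := by linarith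
  rw [mul_div_assoc', le_div_iff₀ hQ]
  have hN : 0 ≤ N := Nat.cast_nonneg _
  have ha : 0 ≤ a := Nat.cast_nonneg _
  have hmc : (m : ℝ) = a + c := hcard.symm
  rw [hmc] at h1
  have hc : 0 ≤ c := Nat.cast_nonneg _
  have h5 : ((1 - z) * c - (x - 1) * a) * S ≤ (a + c) * N := by
    nlinarith [mul_nonneg (add_nonneg ha hc) hGm]
  have h6 : (x - z) * X ≤ (x - 1) * S + N := by linarith
  have h7 : (x - z) * (X * ((1 - z) * c - (x - 1) * a)) ≤ (x - z) * (N * c) := by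
    calc (x - z) * (X * ((1 - z) * c - (x - 1) * a))
        = ((x - z) * X) * ((1 - z) * c - (x - 1) * a) := by ring
      _ ≤ ((x - 1) * S + N) * ((1 - z) * c - (x - 1) * a) := by gcongr
      _ = (x - 1) * (((1 - z) * c - (x - 1) * a) * S) + N * ((1 - z) * c - (x - 1) * a) := by ring
      _ ≤ (x - 1) * ((a + c) * N) + N * ((1 - z) * c - (x - 1) * a) := by
          gcongr
      _ = (x - z) * (N * c) := by ring
  exact le_of_mul_le_mul_left h7 hxz

end Row

/-- Independence of one coordinate from the others, for the uniform law on a finite product. -/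
theorem sum_pi_mul_of_update_eq {ι : Type*} [Fintype ι] [DecidableEq ι] {β : ι → Type*}
    [∀ i, Fintype (β i)] (r : ι) (f : β r → ℝ) (g : (∀ i, β i) → ℝ)
    (hg : ∀ C π, g (Function.update C r π) = g C) :
    (∑ C, f (C r) * g C) * Fintype.card (β r) = (∑ π, f π) * ∑ C, g C := by
  -- Resampling: exchange coordinate `r` with an independent copy.
  have hinv : Function.Involutive fun t : (∀ i, β i) × β r =>
      (Function.update t.1 r t.2, t.1 r) := by
    rintro ⟨C, π⟩
    simp
  have h : ∑ t : (∀ i, β i) × β r, f (t.1 r) * g t.1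
      = ∑ t : (∀ i, β i) × β r, f t.2 * g t.1 :=
    Fintype.sum_bijective _ hinv.bijective _ _ fun t => by simp [hg]
  rw [Fintype.sum_prod_type, Fintype.sum_prod_type_right] at h
  simp only [sum_const, card_univ, nsmul_eq_mul, ← mul_sum, ← sum_mul] at h
  rw [← h, mul_comm]

/-! ### Forests encoded by idempotent root maps. -/

variable {n : ℕ}

/-- The component of the root `r`, for the root map `ρ` of a forest. -/
def component (ρ : Fin n → Fin n) (r : Fin n) : Finset (Fin n) := {v | ρ v = r}

/-- The roots of the forest with root map `ρ`. -/
def roots (ρ : Fin n → Fin n) : Finset (Fin n) := {v | ρ v = v}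

/-- The root map after the root `r` has been joined to the vertex `j`. -/
def merge (ρ : Fin n → Fin n) (r j : Fin n) : Fin n → Fin n :=
  fun v => if ρ v = r then ρ j else ρ v

theorem mem_component {ρ : Fin n → Fin n} {r v : Fin n} : v ∈ component ρ r ↔ ρ v = r := by
  simp [component]

theorem mem_roots {ρ : Fin n → Fin n} {v : Fin n} : v ∈ roots ρ ↔ ρ v = v := by
  simp [roots]

theorem merge_idem {ρ : Fin n → Fin n} (hρ : ∀ v, ρ (ρ v) = ρ v) {r j : Fin n}
    (hj : ρ j ≠ r) (v : Fin n) : merge ρ r j (merge ρ r j v) = merge ρ r j v := by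
  simp only [merge]
  by_cases h : ρ v = r <;> simp [h, hρ, hj]

theorem roots_merge {ρ : Fin n → Fin n} (hρ : ∀ v, ρ (ρ v) = ρ v) {r j : Fin n}
    (hr : ρ r = r) (hj : ρ j ≠ r) : roots (merge ρ r j) = (roots ρ).erase r := by
  ext v
  simp only [mem_roots, mem_erase, merge]
  by_cases h : ρ v = r
  · rw [if_pos h]
    constructor
    · intro h'
      exact absurd ((hρ j).symm.trans (h' ▸ h)) hj
    · rintro ⟨h1, h2⟩
      exact absurd (h2.symm.trans h) h1
  · rw [if_neg h]
    refine ⟨fun h' => ⟨fun h2 => h (h2 ▸ hr), h'⟩, fun h' => h'.2⟩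

theorem card_roots_merge {ρ : Fin n → Fin n} (hρ : ∀ v, ρ (ρ v) = ρ v) {r j : Fin n}
    (hr : ρ r = r) (hj : ρ j ≠ r) {k : ℕ} (hk : #(roots ρ) = k + 1) :
    #(roots (merge ρ r j)) = k := by
  rw [roots_merge hρ hr hj, card_erase_of_mem (mem_roots.2 hr), hk, Nat.add_sub_cancel]

theorem component_subset_merge {ρ : Fin n → Fin n} {r j v : Fin n} (hv : v ≠ r) :
    component ρ v ⊆ component (merge ρ r j) v := by
  intro u hu
  rw [mem_component] at hu ⊢
  simp [merge, hu, hv]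

theorem sum_card_component {ρ : Fin n → Fin n} (hρ : ∀ v, ρ (ρ v) = ρ v) :
    ∑ r ∈ roots ρ, #(component ρ r) = n := by
  have h := card_eq_sum_card_fiberwise (f := ρ) (s := univ) (t := roots ρ)
    fun v _ => mem_coe.2 (mem_roots.2 (hρ v))
  rw [card_univ, Fintype.card_fin] at h
  exact h.symm

theorem card_roots_mul_le {ρ : Fin n → Fin n} (hρ : ∀ v, ρ (ρ v) = ρ v) {r : Fin n}
    (hmin : ∀ v ∈ roots ρ, #(component ρ r) ≤ #(component ρ v)) :
    #(roots ρ) * #(component ρ r) ≤ n := by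
  rw [← smul_eq_mul]
  exact (card_nsmul_le_sum _ _ _ hmin).trans_eq (sum_card_component hρ)

/-! ### The weighted sum over courses and its mean. -/

/-- The vertices outside the component of the root `r`. -/
def targets (ρ : Fin n → Fin n) (r : Fin n) : Finset {j : Fin n // j ≠ r} :=
  univ.filter fun j => ρ j ≠ r

theorem mem_targets {ρ : Fin n → Fin n} {r : Fin n} {j : {j : Fin n // j ≠ r}} :
    j ∈ targets ρ r ↔ ρ j ≠ r := by
  simp [targets]

/-- The factor `x` for every cheaper edge from `r` to its own component, and `z` for every
other cheaper edge. -/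
noncomputable def rowWeight (x z : ℝ) (ρ : Fin n → Fin n) (r : Fin n) (π : Row n r)
    (j : {j : Fin n // j ≠ r}) : ℝ :=
  ∏ i, if π i < π j then (if ρ i = r then x else z) else 1

theorem rowWeight_nonneg {x z : ℝ} (hx : 0 ≤ x) (hz : 0 ≤ z) (ρ : Fin n → Fin n) (r : Fin n)
    (π : Row n r) (j : {j : Fin n // j ≠ r}) : 0 ≤ rowWeight x z ρ r π j := by
  refine prod_nonneg fun i _ => ?_
  split_ifs <;> first | assumption | exact zero_le_one

theorem card_subtype_component {ρ : Fin n → Fin n} {r : Fin n} (hr : ρ r = r) :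
    #{i : {i : Fin n // i ≠ r} | ρ i = r} + 1 = #(component ρ r) := by
  have h : ({i : {i : Fin n // i ≠ r} | ρ i = r} : Finset _).map (Function.Embedding.subtype _)
      = (component ρ r).erase r := by
    ext v
    simp [mem_component, and_comm]
  rw [← card_map, h, card_erase_add_one (mem_component.2 hr)]

/-- If the component is at most a 1/(K+1) fraction of all vertices, there are at least `K` targets
for each inner vertex, so the inner edges worsen 1 - z by at most (x-1)/K. -/
theorem sum_rowWeight_le {x z : ℝ} (hz : 0 ≤ z) (hz1 : z < 1) (hx : 1 ≤ x)
    (hxz : x - 1 < 1 - z) {ρ : Fin n → Fin n} {r : Fin n} (hr : ρ r = r) {K : ℕ} (hK : 1 ≤ K)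
    (hcard : (K + 1) * #(component ρ r) ≤ n) :
    ∑ π : Row n r, ∑ j ∈ targets ρ r, rowWeight x z ρ r π j
      ≤ (Fintype.card (Row n r) : ℝ) * (1 - z - (x - 1) / K)⁻¹ := by
  set A : Finset {i : Fin n // i ≠ r} := {i : {i : Fin n // i ≠ r} | ρ i = r} with hA
  have hAc : targets ρ r = Aᶜ := by
    ext j; simp [A, mem_targets]
  have hm : Fintype.card {j : Fin n // j ≠ r} = n - 1 := by
    rw [Fintype.card_subtype_compl]; simp
  have hn : 0 < n := r.pos
  have ha := card_subtype_component hr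
  rw [← hA] at ha
  have hac := card_add_card_compl A
  rw [hm] at hac
  have hle : K * #A + K ≤ #Aᶜ := by
    rw [← ha] at hcard
    nlinarith [Nat.sub_add_cancel hn]
  have hKpos : (0 : ℝ) < K := by exact_mod_cast hK
  have hK1 : (1 : ℝ) ≤ K := by exact_mod_cast hK
  have hle' : (K : ℝ) * #A ≤ #Aᶜ := by exact_mod_cast (by omega : K * #A ≤ #Aᶜ)
  have hcpos : (0 : ℝ) < #Aᶜ := by exact_mod_cast (by omega : 0 < #Aᶜ)
  have hD : 0 < 1 - z - (x - 1) / K := by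
    have : (x - 1) / K ≤ x - 1 := div_le_self (by linarith) hK1
    linarith
  have hkey : (1 - z - (x - 1) / K) * #Aᶜ ≤ (1 - z) * #Aᶜ - (x - 1) * #A := by
    have : (x - 1) * #A ≤ (x - 1) / K * #Aᶜ := by
      rw [div_mul_eq_mul_div, le_div_iff₀ hKpos]
      nlinarith
    linarith
  have hpos : 0 < (1 - z) * #Aᶜ - (x - 1) * #A := lt_of_lt_of_le (mul_pos hD hcpos) hkey
  have hmain := sum_equiv_sum_outside_le A hz hz1 hx hm (by linarith)
  simp only [rowWeight, hAc]
  calc _ = ∑ π : {j : Fin n // j ≠ r} ≃ Fin (n - 1), ∑ j ∈ Aᶜ,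
          ∏ i, (if π i < π j then (if i ∈ A then x else z) else 1) := by simp [A]
    _ ≤ _ := hmain
    _ ≤ _ := by
      gcongr
      rw [div_le_iff₀ hpos, inv_mul_eq_div, le_div_iff₀ hD]
      linarith

/-- The total weight of all courses of `k` moves of Maker from the root map `ρ`.  In every move
she joins a root `r` whose component is not larger than `n / 2` to a vertex outside it; the move
has the factor `rowWeight` and, unless `r` is the root given by `pick`, the factor `y`. -/
noncomputable def courseSum (x z y : ℝ) (pick : (Fin n → Fin n) → Fin n) :
    ℕ → (Fin n → Fin n) → Costs n → ℝ
  | 0, _, _ => 1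
  | k + 1, ρ, C => ∑ r : Fin n with ρ r = r ∧ 2 * #(component ρ r) ≤ n,
      (if r = pick ρ then 1 else y) * ∑ j ∈ targets ρ r,
        rowWeight x z ρ r (C r) j * courseSum x z y pick k (merge ρ r j) C

theorem courseSum_nonneg {x z y : ℝ} (hx : 0 ≤ x) (hz : 0 ≤ z) (hy : 0 ≤ y)
    (pick : (Fin n → Fin n) → Fin n) (k : ℕ) (ρ : Fin n → Fin n) (C : Costs n) :
    0 ≤ courseSum x z y pick k ρ C := by
  induction k generalizing ρ with
  | zero => exact zero_le_one
  | succ k ih =>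
    refine sum_nonneg fun r _ => mul_nonneg (by split_ifs <;> simp [hy])
      (sum_nonneg fun j _ => mul_nonneg (rowWeight_nonneg hx hz _ _ _ _) (ih _))

/-- One actual move is one term of a nonnegative sum; this keeps accumulated weight times remaining
sum from increasing during play. -/
theorem mul_courseSum_le {x z y : ℝ} (hx : 0 ≤ x) (hz : 0 ≤ z) (hy : 0 ≤ y)
    (pick : (Fin n → Fin n) → Fin n) (k : ℕ) {ρ : Fin n → Fin n} (C : Costs n) {r : Fin n}
    (hr : ρ r = r) (hsize : 2 * #(component ρ r) ≤ n) (j : {j : Fin n // j ≠ r})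
    (hj : ρ j ≠ r) :
    (if r = pick ρ then 1 else y) *
        (rowWeight x z ρ r (C r) j * courseSum x z y pick k (merge ρ r j) C)
      ≤ courseSum x z y pick (k + 1) ρ C := by
  have hcs := courseSum_nonneg hx hz hy pick k
  rw [courseSum]
  refine le_trans ?_ (single_le_sum (a := r) (fun r _ => mul_nonneg (by split_ifs <;> simp [hy])
      (sum_nonneg fun j _ => mul_nonneg (rowWeight_nonneg hx hz _ _ _ _) (hcs _ _)))
      (by simp [hr, hsize]))
  refine mul_le_mul_of_nonneg_left ?_ (by split_ifs <;> simp [hy])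
  exact single_le_sum (a := j) (f := fun j : {j : Fin n // j ≠ r} =>
    rowWeight x z ρ r (C r) j * courseSum x z y pick k (merge ρ r j) C)
    (fun j _ => mul_nonneg (rowWeight_nonneg hx hz _ _ _ _) (hcs _ _)) (mem_targets.2 hj)

/-- The rows of the vertices that are no longer roots do not matter. -/
theorem courseSum_update (x z y : ℝ) (pick : (Fin n → Fin n) → Fin n) (k : ℕ)
    {ρ : Fin n → Fin n} (hρ : ∀ v, ρ (ρ v) = ρ v) {v : Fin n} (hv : ρ v ≠ v)
    (C : Costs n) (π : Row n v) :
    courseSum x z y pick k ρ (Function.update C v π) = courseSum x z y pick k ρ C := by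
  induction k generalizing ρ with
  | zero => rfl
  | succ k ih =>
    simp only [courseSum]
    refine sum_congr rfl fun r hr => ?_
    congr 1
    refine sum_congr rfl fun j hj => ?_
    rw [mem_filter] at hr
    rw [mem_targets] at hj
    have hrv : r ≠ v := fun h => hv (h ▸ hr.2.1)
    rw [Function.update_of_ne hrv, ih (merge_idem hρ hj)]
    have h := roots_merge hρ hr.2.1 hj
    intro h'
    exact hv (mem_roots.1 (mem_of_mem_erase (h ▸ mem_roots.2 h')))

/-- After `r` has moved, the remaining sum ignores row `r`, so the mean factorizes and induction
applies. With i + 2 roots left, the picked component has at most n/(i+2) vertices, giving the first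
summand; each of the at most n other roots has at most n/2 and pays `y`, giving the second. -/
theorem sum_courseSum_le {x z y : ℝ} (hz : 0 ≤ z) (hz1 : z < 1) (hx : 1 ≤ x)
    (hxz : x - 1 < 1 - z) (hy : 0 ≤ y) {pick : (Fin n → Fin n) → Fin n}
    (hpick : ∀ ρ : Fin n → Fin n, (∀ v, ρ (ρ v) = ρ v) →
      ∀ v ∈ roots ρ, #(component ρ (pick ρ)) ≤ #(component ρ v))
    (k : ℕ) {ρ : Fin n → Fin n} (hρ : ∀ v, ρ (ρ v) = ρ v) (hk : #(roots ρ) = k + 1) :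
    ∑ C, courseSum x z y pick k ρ C ≤ (Fintype.card (Costs n) : ℝ) *
      ∏ i ∈ range k, ((1 - z - (x - 1) / ((i + 1 : ℕ) : ℝ))⁻¹ + n * y * (2 - z - x)⁻¹) := by
  have hg : ∀ i : ℕ, 0 ≤ (1 - z - (x - 1) / ((i + 1 : ℕ) : ℝ))⁻¹ := fun i => by
    have : (x - 1) / ((i + 1 : ℕ) : ℝ) ≤ x - 1 :=
      div_le_self (by linarith) (by push_cast; linarith [Nat.cast_nonneg (α := ℝ) i])
    exact inv_nonneg.2 (by linarith)
  have hH : 0 ≤ (2 - z - x)⁻¹ := inv_nonneg.2 (by linarith)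
  induction k generalizing ρ with
  | zero => simp [courseSum]
  | succ k ih =>
    set N := (Fintype.card (Costs n) : ℝ) with hN
    set Q := ∏ i ∈ range k, ((1 - z - (x - 1) / ((i + 1 : ℕ) : ℝ))⁻¹ + n * y * (2 - z - x)⁻¹)
      with hQ
    have hQ0 : 0 ≤ Q := prod_nonneg fun i _ => add_nonneg (hg i)
      (mul_nonneg (mul_nonneg (Nat.cast_nonneg _) hy) hH)
    have hN0 : 0 ≤ N := Nat.cast_nonneg _
    rw [prod_range_succ, ← hQ]
    simp only [courseSum]
    rw [sum_comm]
    have hrow : ∀ r, ρ r = r → ∀ K : ℕ, 1 ≤ K → (K + 1) * #(component ρ r) ≤ n →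
        ∑ C : Costs n, ∑ j ∈ targets ρ r,
          rowWeight x z ρ r (C r) j * courseSum x z y pick k (merge ρ r j) C
        ≤ N * Q * (1 - z - (x - 1) / K)⁻¹ := by
      intro r hr K hK hKr
      have hcardpos : 0 < (Fintype.card (Row n r) : ℝ) ∨ Fintype.card (Row n r) = 0 := by
        rcases Nat.eq_zero_or_pos (Fintype.card (Row n r)) with h | h
        · exact Or.inr h
        · exact Or.inl (by exact_mod_cast h)
      rcases hcardpos with hpos | h0
      · rw [sum_comm]
        refine le_of_mul_le_mul_right ?_ hpos
        rw [sum_mul]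
        calc ∑ j ∈ targets ρ r,
              (∑ C : Costs n, rowWeight x z ρ r (C r) j *
                courseSum x z y pick k (merge ρ r j) C) * (Fintype.card (Row n r) : ℝ)
            ≤ ∑ j ∈ targets ρ r,
              (∑ π : Row n r, rowWeight x z ρ r π j) * (N * Q) := by
              refine sum_le_sum fun j hj => ?_
              have hj' := mem_targets.1 hj
              rw [sum_pi_mul_of_update_eq r (fun π => rowWeight x z ρ r π j)]
              · exact mul_le_mul_of_nonneg_left
                  (ih (merge_idem hρ hj') (card_roots_merge hρ hr hj' hk))
                  (sum_nonneg fun π _ => rowWeight_nonneg (by linarith) hz _ _ _ _)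
              · intro C π
                refine courseSum_update x z y pick k (merge_idem hρ hj') ?_ C π
                simp [merge, hr, hj']
          _ = (∑ π : Row n r, ∑ j ∈ targets ρ r,
                rowWeight x z ρ r π j) * (N * Q) := by rw [sum_comm, sum_mul]
          _ ≤ ((Fintype.card (Row n r) : ℝ) * (1 - z - (x - 1) / K)⁻¹) * (N * Q) :=
              mul_le_mul_of_nonneg_right (sum_rowWeight_le hz hz1 hx hxz hr hK hKr)
                (mul_nonneg hN0 hQ0)
          _ = _ := by ring
      · have : IsEmpty (Costs n) := by
          have := Fintype.card_eq_zero_iff.1 h0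
          exact ⟨fun C => this.elim (C r)⟩
        simp [hN]
    have hterm : ∀ r ∈ ({r : Fin n | ρ r = r ∧ 2 * #(component ρ r) ≤ n} : Finset _),
        ∑ C : Costs n, (if r = pick ρ then 1 else y) * ∑ j ∈ targets ρ r,
          rowWeight x z ρ r (C r) j * courseSum x z y pick k (merge ρ r j) C
        ≤ N * Q * ((if r = pick ρ then (1 - z - (x - 1) / ((k + 1 : ℕ) : ℝ))⁻¹ else 0)
            + y * (2 - z - x)⁻¹) := by
      intro r hr
      obtain ⟨hr1, hr2⟩ := (mem_filter.1 hr).2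
      rw [← mul_sum]
      split_ifs with h
      · have hmul : (k + 1 + 1) * #(component ρ r) ≤ n := by
          rw [← hk]
          exact card_roots_mul_le hρ (h ▸ hpick ρ hρ)
        refine (one_mul _).trans_le ((hrow r hr1 (k + 1) (by omega) hmul).trans ?_)
        exact mul_le_mul_of_nonneg_left (le_add_of_nonneg_right (mul_nonneg hy hH))
          (mul_nonneg hN0 hQ0)
      -- A component of at most half the vertices allows only K = 1, where the denominator is 2 - z
      -- - x.
      · have h2 := hrow r hr1 1 le_rfl (by simpa using hr2)
        have e : 1 - z - (x - 1) / ((1 : ℕ) : ℝ) = 2 - z - x := by push_cast; ring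
        rw [e] at h2
        refine (mul_le_mul_of_nonneg_left h2 hy).trans_eq ?_
        ring
    refine (sum_le_sum hterm).trans ?_
    rw [← mul_sum, ← mul_assoc]
    refine mul_le_mul_of_nonneg_left ?_ (mul_nonneg hN0 hQ0)
    rw [sum_add_distrib]
    refine add_le_add ?_ ?_
    · rw [sum_ite_eq']
      split_ifs
      exacts [le_rfl, hg k]
    · rw [sum_const, nsmul_eq_mul, ← mul_assoc]
      gcongr
      exact (card_filter_le _ _).trans (by simp)

/-! ### Maker's strategy and its invariant. -/

/-- The number of edges of `B` that leave the vertex `v`. -/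
def outDegree (B : Finset (Edge n)) (v : Fin n) : ℕ := #{e ∈ B | e.1.1 = v}

/-- The edge from `r` to `j`. -/
def edgeTo {r : Fin n} (j : {j : Fin n // j ≠ r}) : Edge n := ⟨(r, j), j.2.symm⟩

theorem outDegree_union_le (B D : Finset (Edge n)) (v : Fin n) :
    outDegree (B ∪ D) v ≤ outDegree B v + outDegree D v := by
  rw [outDegree, filter_union]
  exact card_union_le _ _

theorem sum_outDegree_le (D : Finset (Edge n)) (s : Finset (Fin n)) :
    ∑ v ∈ s, outDegree D v ≤ #D := by
  simp only [outDegree]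
  rw [sum_card_fiberwise_eq_card_filter]
  exact card_filter_le _ _

theorem outDegree_le_card (D : Finset (Edge n)) (v : Fin n) : outDegree D v ≤ #D :=
  card_filter_le _ _

theorem card_le_outDegree {B : Finset (Edge n)} {r : Fin n} {s : Finset {j : Fin n // j ≠ r}}
    (hs : ∀ j ∈ s, edgeTo j ∈ B) : #s ≤ outDegree B r := by
  refine card_le_card_of_injOn edgeTo (fun j hj => ?_) ?_
  · exact mem_coe.2 (mem_filter.2 ⟨hs j hj, rfl⟩)
  · intro i _ j _ hij
    exact Subtype.ext (congrArg (fun e : Edge n => e.1.2) hij)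

theorem card_targets_add {ρ : Fin n → Fin n} {r : Fin n} (hr : ρ r = r) :
    #(targets ρ r) + #(component ρ r) = n := by
  have h1 := card_subtype_component hr
  have h2 := card_filter_add_card_filter_not (s := (univ : Finset {j : Fin n // j ≠ r}))
    (fun j => ρ j = r)
  have hm : Fintype.card {j : Fin n // j ≠ r} = n - 1 := by
    rw [Fintype.card_subtype_compl]; simp
  rw [card_univ, hm] at h2
  have hn : 0 < n := r.pos
  have h3 : targets ρ r = univ.filter (fun j : {j : Fin n // j ≠ r} => ¬ ρ j = r) := by
    ext; simp [targets]
  rw [h3]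
  omega

/-- The number of cheaper edges from `r` to its own component. -/
def insideCount (ρ : Fin n → Fin n) (r : Fin n) (π : Row n r) (j : {j : Fin n // j ≠ r}) : ℕ :=
  #{i : {j : Fin n // j ≠ r} | π i < π j ∧ ρ i = r}

/-- The number of cheaper edges from `r` to other components. -/
def outsideCount (ρ : Fin n → Fin n) (r : Fin n) (π : Row n r) (j : {j : Fin n // j ≠ r}) : ℕ :=
  #{i : {j : Fin n // j ≠ r} | π i < π j ∧ ρ i ≠ r}

theorem rowWeight_eq (x z : ℝ) (ρ : Fin n → Fin n) (r : Fin n) (π : Row n r)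
    (j : {j : Fin n // j ≠ r}) :
    rowWeight x z ρ r π j = x ^ insideCount ρ r π j * z ^ outsideCount ρ r π j := by
  rw [rowWeight, ← prod_filter, prod_ite, prod_const, prod_const, filter_filter, filter_filter]
  rfl

theorem cost_edgeTo (C : Costs n) (ρ : Fin n → Fin n) {r : Fin n} (j : {j : Fin n // j ≠ r}) :
    cost C (edgeTo j) = 1 + insideCount ρ r (C r) j + outsideCount ρ r (C r) j := by
  have h1 : #{i : {j : Fin n // j ≠ r} | C r i < C r j} = (C r j : ℕ) := by
    have : ({i : {j : Fin n // j ≠ r} | C r i < C r j} : Finset _)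
        = (Iio (C r j)).map (C r).symm.toEmbedding := by
      ext i
      simp
    rw [this, card_map, Fin.card_Iio]
  have h2 := card_filter_add_card_filter_not
    (s := ({i : {j : Fin n // j ≠ r} | C r i < C r j} : Finset _)) (fun i => ρ i = r)
  rw [filter_filter, filter_filter, h1] at h2
  have h3 : cost C (edgeTo j) = (C r j : ℕ) + 1 := rfl
  rw [h3, insideCount, outsideCount, ← h2]
  ring

/-- The cheapest edge from `r` to another component that is not in `B`. -/
theorem exists_cheapest_target {ρ : Fin n → Fin n} {r : Fin n} (hr : ρ r = r) (π : Row n r)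
    {B : Finset (Edge n)} (hB : outDegree B r + #(component ρ r) < n) :
    ∃ j : {j : Fin n // j ≠ r}, ρ j ≠ r ∧ edgeTo j ∉ B ∧ outsideCount ρ r π j ≤ outDegree B r := by
  have hne : ((targets ρ r).filter fun j => edgeTo j ∉ B).Nonempty := by
    by_contra h
    rw [not_nonempty_iff_eq_empty, filter_eq_empty_iff] at h
    have h1 := card_le_outDegree (s := targets ρ r) fun j hj => not_not.1 (h hj)
    have h2 := card_targets_add hr
    omega
  obtain ⟨j, hj, hmin⟩ := exists_min_image _ (fun j => π j) hne
  rw [mem_filter, mem_targets] at hj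
  -- A cheaper edge to another component that survived would contradict minimality, so all of them
  -- lie in `B`.
  refine ⟨j, hj.1, hj.2, card_le_outDegree fun i hi => ?_⟩
  rw [mem_filter] at hi
  by_contra h
  exact absurd (hmin i (mem_filter.2 ⟨mem_targets.2 hi.2.2, h⟩)) (not_le.2 hi.2.1)

/-- What Maker maintains: she holds `M`, Breaker has deleted `B`, the forest `M` has the root map
`ρ`, the cheaper edges skipped so far are `W` inside and `D` outside the components, and at most
`U` moves were made at a root with at least `T` deleted edges. -/
structure Position (b T : ℕ) (C : Costs n) (M B : Finset (Edge n)) (ρ : Fin n → Fin n)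
    (W D U : ℕ) : Prop where
  idem : ∀ v, ρ (ρ v) = ρ v
  path : ∀ v, Relation.ReflTransGen (Arc M) v (ρ v)
  card : #M + #(roots ρ) = n
  source : ∀ e ∈ M, ρ e.1.1 ≠ e.1.1
  total : ∑ e ∈ M, cost C e = #M + W + D
  outside : D + ∑ v ∈ roots ρ, outDegree B v ≤ b * #M
  urgent : T * U + ∑ v ∈ roots ρ, outDegree B v ≤ b * #M
  danger : ∀ v, ρ v = v → 2 * #(component ρ v) ≤ n → outDegree B v ≤ T + b * (U + 1)

theorem position_initial (b T : ℕ) (C : Costs n) : Position b T C ∅ ∅ id 0 0 0 where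
  idem _ := rfl
  path _ := .refl
  card := by simp [roots]
  source e he := by simp at he
  total := by simp
  outside := by simp [outDegree]
  urgent := by simp [outDegree]
  danger v _ _ := by simp [outDegree]

theorem Arc.mono {M M' : Finset (Edge n)} (h : M ⊆ M') {i j : Fin n} : Arc M i j → Arc M' i j :=
  fun ⟨e, he, heq⟩ => ⟨e, h he, heq⟩

/-- The two budgets survive because the deleted edges at `r` leave the sum over roots just when they
pay for the outer skips or for the emergency (`u = 1`). Components of surviving roots only grow, so
a root that is small now was small before, which preserves `danger`. -/
theorem Position.step {b T : ℕ} {C : Costs n} {M B : Finset (Edge n)} {ρ : Fin n → Fin n}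
    {W D U : ℕ} (P : Position b T C M B ρ W D U) {r : Fin n} (hr : ρ r = r)
    {j : {j : Fin n // j ≠ r}} (hj : ρ j ≠ r)
    (hout : outsideCount ρ r (C r) j ≤ outDegree B r) {u : ℕ} (hu : T * u ≤ outDegree B r)
    (hdanger : ∀ v, ρ v = v → 2 * #(component ρ v) ≤ n → outDegree B v ≤ T + b * (U + u))
    {E : Finset (Edge n)} (hE : #E ≤ b) :
    Position b T C (insert (edgeTo j) M) (B ∪ E) (merge ρ r j)
      (W + insideCount ρ r (C r) j) (D + outsideCount ρ r (C r) j) (U + u) := by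
  have hnotin : edgeTo j ∉ M := fun h => P.source _ h hr
  have hcard : #(insert (edgeTo j) M) = #M + 1 := card_insert_of_notMem hnotin
  have hroots := roots_merge P.idem hr hj
  have hrmem : r ∈ roots ρ := mem_roots.2 hr
  have hsum : ∑ v ∈ roots (merge ρ r j), outDegree (B ∪ E) v + outDegree B r
      ≤ ∑ v ∈ roots ρ, outDegree B v + b := by
    rw [hroots, ← sum_erase_add _ _ hrmem]
    have h1 := sum_le_sum fun v (_ : v ∈ (roots ρ).erase r) => outDegree_union_le B E v
    rw [sum_add_distrib] at h1
    have h2 := sum_outDegree_le E ((roots ρ).erase r)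
    omega
  refine ⟨merge_idem P.idem hj, fun v => ?_, ?_, fun e he => ?_, ?_, ?_, ?_, fun v hv hsize => ?_⟩
  · have hsub := subset_insert (edgeTo j) M
    by_cases h : ρ v = r
    · have h1 : merge ρ r j v = ρ j := by simp [merge, h]
      rw [h1]
      have h2 := Relation.ReflTransGen.mono (fun _ _ => Arc.mono hsub) _ _ (P.path v)
      have h3 := Relation.ReflTransGen.mono (fun _ _ => Arc.mono hsub) _ _ (P.path j)
      rw [h] at h2
      exact (h2.tail ⟨edgeTo j, mem_insert_self _ _, rfl⟩).trans h3
    · have h1 : merge ρ r j v = ρ v := by simp [merge, h]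
      rw [h1]
      exact Relation.ReflTransGen.mono (fun _ _ => Arc.mono hsub) _ _ (P.path v)
  · rw [hcard, hroots, card_erase_of_mem hrmem]
    have := P.card
    have : 0 < #(roots ρ) := card_pos.2 ⟨r, hrmem⟩
    omega
  · rw [ne_eq, ← mem_roots, hroots, mem_erase, not_and, mem_roots]
    rcases mem_insert.1 he with rfl | he
    · exact fun h => absurd rfl h
    · exact fun _ => P.source e he
  · rw [sum_insert hnotin, hcard, P.total, cost_edgeTo C ρ]
    ring
  · rw [hcard, mul_add, mul_one]
    have := P.outside
    omega
  · rw [hcard, mul_add, mul_add, mul_one]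
    have := P.urgent
    omega
  · have hv' := hroots ▸ mem_roots.2 hv
    rw [mem_erase, mem_roots] at hv'
    have h1 := card_le_card (component_subset_merge (ρ := ρ) (j := j) hv'.1)
    have h2 := hdanger v hv'.2 (by omega)
    have h3 := outDegree_union_le B E v
    have h4 := outDegree_le_card E v
    rw [mul_add, mul_one]
    omega

/-- With one root, `M` has n - 1 edges and connects everything. Connectivity needs n - 1 undirected
edges, so forgetting orientations is injective on `M`: this yields both the tree and the absence of
opposite pairs. -/
theorem Position.isSpanningArborescence {b T : ℕ} {C : Costs n} {M B : Finset (Edge n)}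
    {ρ : Fin n → Fin n} {W D U : ℕ} (P : Position b T C M B ρ W D U) (h1 : #(roots ρ) = 1) :
    IsSpanningArborescence M := by
  obtain ⟨r, hr⟩ := card_eq_one.1 h1
  have hroot : ∀ v, ρ v = r := fun v =>
    mem_singleton.1 (hr ▸ mem_roots.2 (P.idem v))
  have hpath : ∀ v, Relation.ReflTransGen (Arc M) v r := fun v => hroot v ▸ P.path v
  set G := SimpleGraph.fromRel (Arc M) with hG
  have hadj : ∀ i j, Arc M i j → G.Adj i j := by
    rintro i j ⟨e, he, heq⟩
    refine (SimpleGraph.fromRel_adj _ _ _).2 ⟨?_, Or.inl ⟨e, he, heq⟩⟩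
    have := e.2
    rw [heq] at this
    exact this
  have hreach : ∀ v, G.Reachable v r := by
    intro v
    induction hpath v using Relation.ReflTransGen.head_induction_on with
    | refl => rfl
    | head h _ ih => exact (hadj _ _ h).reachable.trans ih
  have hconn : G.Connected :=
    { preconnected := fun u v => (hreach u).trans (hreach v).symm
      nonempty := ⟨r⟩ }
  have hM := P.card
  rw [h1] at hM
  classical
  set f : Edge n → Sym2 (Fin n) := fun e => s(e.1.1, e.1.2) with hf
  have himage : M.image f = G.edgeFinset := by
    ext s
    induction s using Sym2.ind with
    | _ i j =>
      rw [mem_image, SimpleGraph.mem_edgeFinset, SimpleGraph.mem_edgeSet]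
      constructor
      · rintro ⟨e, he, heq⟩
        rw [hf, Sym2.eq_iff] at heq
        have := hadj _ _ ⟨e, he, rfl⟩
        rcases heq with ⟨h, h'⟩ | ⟨h, h'⟩
        · exact h ▸ h' ▸ this
        · exact (h ▸ h' ▸ this : G.Adj j i).symm
      · intro h
        rcases (SimpleGraph.fromRel_adj _ _ _).1 h with ⟨_, ⟨e, he, heq⟩ | ⟨e, he, heq⟩⟩
        · exact ⟨e, he, by simp [hf, heq]⟩
        · exact ⟨e, he, by simp [hf, heq, Sym2.eq_swap]⟩
  have hle := hconn.card_vert_le_card_edgeSet_add_one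
  have hcardE : Nat.card G.edgeSet = #(M.image f) := by
    rw [himage, Nat.card_eq_fintype_card, SimpleGraph.edgeFinset_card]
  have hle' : #(M.image f) ≤ #M := card_image_le
  rw [hcardE, Nat.card_eq_fintype_card, Fintype.card_fin] at hle
  refine ⟨SimpleGraph.isTree_iff_connected_and_card.2 ⟨hconn, ?_⟩, ?_, r, hpath⟩
  · rw [hcardE, Nat.card_eq_fintype_card, Fintype.card_fin]
    omega
  · have hinj : Set.InjOn f M := card_image_iff.1 (by omega)
    rintro i j ⟨e, he, heq⟩ ⟨e', he', heq'⟩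
    have := hinj he he' (by simp [hf, heq, heq', Sym2.eq_swap])
    subst this
    have hij : i = j := (Prod.ext_iff.1 (heq.symm.trans heq')).1
    have hne := e.2
    rw [heq] at hne
    exact hne hij

theorem Position.makerForces {b T : ℕ} {C : Costs n} {x z y Λ L : ℝ} (hx : 0 ≤ x) (hz : 0 ≤ z)
    (hy : 0 ≤ y) (hy1 : y ≤ 1) {pick : (Fin n → Fin n) → Fin n}
    (hpick_mem : ∀ ρ : Fin n → Fin n, (∀ v, ρ (ρ v) = ρ v) → pick ρ ∈ roots ρ)
    (hpick : ∀ ρ : Fin n → Fin n, (∀ v, ρ (ρ v) = ρ v) →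
      ∀ v ∈ roots ρ, #(component ρ (pick ρ)) ≤ #(component ρ v))
    (hT : ∀ U, T * U ≤ b * n → 2 * (T + b * (U + 1)) < n)
    (hfinal : ∀ W D U : ℕ, D ≤ b * n → T * U ≤ b * n → x ^ W * z ^ D * y ^ U ≤ Λ →
      ((n + W + D : ℕ) : ℝ) ≤ L)
    {k : ℕ} {M B : Finset (Edge n)} {ρ : Fin n → Fin n} {W D U : ℕ}
    (P : Position b T C M B ρ W D U) (hk : #(roots ρ) = k + 1)
    (hΛ : x ^ W * z ^ D * y ^ U * courseSum x z y pick k ρ C ≤ Λ) :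
    MakerForces b (fun T => IsSpanningArborescence T ∧ ((∑ e ∈ T, cost C e : ℕ) : ℝ) ≤ L)
      k M B := by
  have hbM : b * #M ≤ b * n := Nat.mul_le_mul_left _ (by have := P.card; omega)
  have hD := P.outside
  have hU := P.urgent
  induction k generalizing M B ρ W D U with
  | zero =>
    refine ⟨P.isSpanningArborescence hk, ?_⟩
    rw [courseSum, mul_one] at hΛ
    have h := hfinal W D U (by omega) (by omega) hΛ
    rw [P.total]
    refine le_trans ?_ h
    have := P.card
    exact_mod_cast (by omega : #M + W + D ≤ n + W + D)
  | succ k ih =>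
    obtain ⟨r, u, hr, hsize, hu, hκ, hdanger⟩ : ∃ r u, ρ r = r ∧ 2 * #(component ρ r) ≤ n ∧
        T * u ≤ outDegree B r ∧ y ^ u ≤ (if r = pick ρ then 1 else y) ∧
        ∀ v, ρ v = v → 2 * #(component ρ v) ≤ n → outDegree B v ≤ T + b * (U + u) := by
      -- An endangered small root moves at once. Otherwise the smallest component moves; it is small
      -- since at least two roots remain.
      by_cases h : ∃ r, ρ r = r ∧ 2 * #(component ρ r) ≤ n ∧ T ≤ outDegree B r
      · obtain ⟨r, hr, hsize, hTr⟩ := h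
        refine ⟨r, 1, hr, hsize, by omega, ?_, P.danger⟩
        split_ifs <;> simp [hy1]
      · push Not at h
        refine ⟨pick ρ, 0, mem_roots.1 (hpick_mem ρ P.idem), ?_, by simp, by simp,
          fun v hv hvs => (h v hv hvs).le.trans (Nat.le_add_right _ _)⟩
        have := card_roots_mul_le P.idem (hpick ρ P.idem)
        rw [hk] at this
        exact (Nat.mul_le_mul_right _ (by omega)).trans this
    have hdr := P.danger r hr hsize
    have hTU := hT U (by omega)
    -- The component covers at most half of the vertices and the deletions at `r` number less than
    -- n/2, so a target survives.
    obtain ⟨j, hj, hjB, hout⟩ := exists_cheapest_target hr (C r) (B := B) (by omega)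
    refine ⟨edgeTo j, fun h => P.source _ h hr, hjB, fun E hE _ => ?_⟩
    have P' := P.step hr hj hout hu hdanger hE
    refine ih P' (card_roots_merge P.idem hr hj hk) ?_ ?_ P'.outside P'.urgent
    · refine le_trans ?_ hΛ
      have h1 := mul_courseSum_le hx hz hy pick k C hr hsize j hj
      rw [rowWeight_eq] at h1
      have hcs := courseSum_nonneg hx hz hy pick k (merge ρ r j) C
      calc _ = x ^ W * z ^ D * y ^ U * (y ^ u * (x ^ insideCount ρ r (C r) j *
              z ^ outsideCount ρ r (C r) j * courseSum x z y pick k (merge ρ r j) C)) := by ring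
        _ ≤ x ^ W * z ^ D * y ^ U * ((if r = pick ρ then 1 else y) *
              (x ^ insideCount ρ r (C r) j * z ^ outsideCount ρ r (C r) j *
                courseSum x z y pick k (merge ρ r j) C)) := by gcongr
        _ ≤ _ := by gcongr
    · exact Nat.mul_le_mul_left _ (by have := P'.card; omega)

theorem exists_pick (hn : 0 < n) : ∃ pick : (Fin n → Fin n) → Fin n,
    (∀ ρ : Fin n → Fin n, (∀ v, ρ (ρ v) = ρ v) → pick ρ ∈ roots ρ) ∧
    ∀ ρ : Fin n → Fin n, (∀ v, ρ (ρ v) = ρ v) →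
      ∀ v ∈ roots ρ, #(component ρ (pick ρ)) ≤ #(component ρ v) := by
  have h : ∀ ρ : Fin n → Fin n, ∃ r, (∀ v, ρ (ρ v) = ρ v) →
      r ∈ roots ρ ∧ ∀ v ∈ roots ρ, #(component ρ r) ≤ #(component ρ v) := by
    intro ρ
    by_cases hρ : ∀ v, ρ (ρ v) = ρ v
    · obtain ⟨r, hr, hmin⟩ := exists_min_image (roots ρ) (fun v => #(component ρ v))
        ⟨ρ ⟨0, hn⟩, mem_roots.2 (hρ _)⟩
      exact ⟨r, fun _ => ⟨hr, hmin⟩⟩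
    · exact ⟨⟨0, hn⟩, fun h => absurd h hρ⟩
  choose pick hpick using h
  exact ⟨pick, fun ρ hρ => (hpick ρ hρ).1, fun ρ hρ => (hpick ρ hρ).2⟩

/-! ### The uniform law on cost matrices and Markov's inequality. -/

instance (n : ℕ) (i : Fin n) : Nonempty (Row n i) :=
  ⟨Fintype.equivOfCardEq (by rw [Fintype.card_subtype_compl]; simp)⟩

instance (n : ℕ) (i : Fin n) : MeasurableSingletonClass (Row n i) := ⟨fun _ => trivial⟩

instance (n : ℕ) : MeasureTheory.IsProbabilityMeasure (costLaw n) := by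
  have (i : Fin n) : MeasureTheory.IsProbabilityMeasure
      (ProbabilityTheory.uniformOn (Set.univ : Set (Row n i))) :=
    ProbabilityTheory.isProbabilityMeasure_uniformOn Set.finite_univ Set.univ_nonempty
  unfold costLaw
  infer_instance

theorem costLaw_singleton (n : ℕ) (C : Costs n) :
    (costLaw n).real {C} = (Fintype.card (Costs n) : ℝ)⁻¹ := by
  have (i : Fin n) : MeasureTheory.IsProbabilityMeasure
      (ProbabilityTheory.uniformOn (Set.univ : Set (Row n i))) :=
    ProbabilityTheory.isProbabilityMeasure_uniformOn Set.finite_univ Set.univ_nonempty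
  rw [MeasureTheory.measureReal_def, costLaw, MeasureTheory.Measure.pi_singleton,
    ENNReal.toReal_prod, Fintype.card_pi]
  push_cast
  rw [← prod_inv_distrib]
  refine prod_congr rfl fun i _ => ?_
  rw [ProbabilityTheory.uniformOn_univ, MeasureTheory.Measure.count_singleton]
  simp

/-- Markov's inequality for the uniform law on the cost matrices. -/
theorem one_sub_div_le_costLaw {n : ℕ} {S : Set (Costs n)} {Q Λ : ℝ} (hΛ : 0 < Λ)
    {f : Costs n → ℝ} (hf : ∀ C, 0 ≤ f C) (hsum : ∑ C, f C ≤ (Fintype.card (Costs n) : ℝ) * Q)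
    (hS : ∀ C, f C ≤ Λ → C ∈ S) : 1 - Q / Λ ≤ (costLaw n).real S := by
  classical
  have hN : 0 < (Fintype.card (Costs n) : ℝ) := by exact_mod_cast Fintype.card_pos
  set N := (Fintype.card (Costs n) : ℝ)
  set bad : Finset (Costs n) := {C | Λ < f C} with hbad
  have h1 : (costLaw n).real (bad : Set (Costs n)) = #bad / N := by
    rw [← MeasureTheory.sum_measureReal_singleton, sum_congr rfl fun C _ => costLaw_singleton n C,
      sum_const, nsmul_eq_mul, div_eq_mul_inv]
  have h2 : #bad * Λ ≤ N * Q := by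
    rw [← nsmul_eq_mul]
    refine (card_nsmul_le_sum bad f Λ fun C hC => (mem_filter.1 hC).2.le).trans ?_
    exact (sum_le_univ_sum_of_nonneg hf).trans hsum
  have h3 : (costLaw n).real (bad : Set (Costs n)) ≤ Q / Λ := by
    rw [h1, div_le_div_iff₀ hN hΛ]
    linarith
  have h4 : Sᶜ ⊆ (bad : Set (Costs n)) := fun C hC => by
    simp only [hbad, coe_filter, mem_univ, true_and, Set.mem_ofPred_eq]
    exact lt_of_not_ge fun h => hC (hS C h)
  have h5 := MeasureTheory.measureReal_mono (μ := costLaw n) h4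
  have h6 := MeasureTheory.probReal_compl_eq_one_sub (μ := costLaw n)
    (Set.toFinite S).measurableSet
  linarith

/-- Maker's guarantee for one cost matrix. -/
theorem makerCanAchieve_of_courseSum_le {n b : ℕ} {x z β : ℝ} (hx : 1 < x) (hz : 0 < z)
    (hz1 : z ≤ 1) (hn : 15 ≤ n) (hbn : 4 * (b * (5 * b + 1)) < n)
    {pick : (Fin n → Fin n) → Fin n}
    (hpick_mem : ∀ ρ : Fin n → Fin n, (∀ v, ρ (ρ v) = ρ v) → pick ρ ∈ roots ρ)
    (hpick : ∀ ρ : Fin n → Fin n, (∀ v, ρ (ρ v) = ρ v) →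
      ∀ v ∈ roots ρ, #(component ρ (pick ρ)) ≤ #(component ρ v)) {C : Costs n}
    (hC : courseSum x z ((n : ℝ) ^ 2)⁻¹ pick (n - 1) id C
      ≤ (x ^ β * z ^ b) ^ n * (((n : ℝ) ^ 2)⁻¹) ^ (5 * b)) :
    MakerCanAchieve b C ((β + b + 1) * n) := by
  have hn1 : (1 : ℝ) ≤ n := by exact_mod_cast (by omega : 1 ≤ n)
  set y := ((n : ℝ) ^ 2)⁻¹ with hy
  have hy0 : 0 < y := by positivity
  have hy1 : y ≤ 1 := inv_le_one_of_one_le₀ (one_le_pow₀ hn1)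
  -- The division rounds down; `n ≥ 15` ensures n ≤ 5 * (n / 4), whence the 5.
  have hUle : ∀ U, n / 4 * U ≤ b * n → U ≤ 5 * b := by
    intro U hU
    by_contra! h
    have h1 : n / 4 * (5 * b + 1) ≤ b * n := (Nat.mul_le_mul_left _ h).trans hU
    have h2 : n ≤ 5 * (n / 4) := by omega
    have h3 : b * n ≤ b * (5 * (n / 4)) := Nat.mul_le_mul_left _ h2
    have h4 : 0 < n / 4 := by omega
    nlinarith
  refine (position_initial b (n / 4) C).makerForces (x := x) (z := z) (y := y) (by linarith)
    hz.le hy0.le hy1 hpick_mem hpick (fun U hU => ?_) (fun W D U hD hU hle => ?_) ?_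
    (by simpa using hC)
  · have h1 : b * (U + 1) ≤ b * (5 * b + 1) :=
      Nat.mul_le_mul_left _ (Nat.add_le_add_right (hUle U hU) 1)
    omega
  · have hzD : z ^ (b * n) ≤ z ^ D := pow_le_pow_of_le_one hz.le hz1 hD
    have hyU : y ^ (5 * b) ≤ y ^ U := pow_le_pow_of_le_one hy0.le hy1 (hUle U hU)
    have hxW : x ^ W ≤ (x ^ β) ^ n := by
      have hpos : 0 < z ^ (b * n) * y ^ (5 * b) := by positivity
      refine le_of_mul_le_mul_right ?_ hpos
      calc x ^ W * (z ^ (b * n) * y ^ (5 * b)) ≤ x ^ W * (z ^ D * y ^ U) := by gcongr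
        _ = x ^ W * z ^ D * y ^ U := by ring
        _ ≤ _ := hle
        _ = _ := by rw [mul_pow, ← pow_mul, mul_assoc]
    have hW : (W : ℝ) ≤ β * n := by
      rw [← Real.rpow_natCast, ← Real.rpow_natCast, ← Real.rpow_mul (by linarith)] at hxW
      exact (Real.rpow_le_rpow_left_iff hx).1 hxW
    have hD' : (D : ℝ) ≤ b * n := by exact_mod_cast hD
    push_cast
    linarith
  · simp only [roots, id_eq, filter_true, card_univ, Fintype.card_fin]
    omega

/-! ### Asymptotics in n. -/

theorem prod_le_const_mul_pow {g : ℕ → ℝ} {R q : ℝ} (hg : ∀ i, 0 ≤ g i) (hR : 1 ≤ R)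
    (hq : 1 ≤ q) {K : ℕ} (hgR : ∀ i, g i ≤ R) (hgq : ∀ i, K ≤ i → g i ≤ q) (m : ℕ) :
    ∏ i ∈ range m, g i ≤ R ^ K * q ^ m := by
  have h1 : ∀ i ∈ range m, g i ≤ (if i < K then R else 1) * q := by
    intro i _
    split_ifs with h
    · exact (hgR i).trans (le_mul_of_one_le_right (by linarith) hq)
    · exact (hgq i (not_lt.1 h)).trans_eq (one_mul q).symm
  refine (prod_le_prod (fun i _ => hg i) h1).trans ?_
  rw [prod_mul_distrib, prod_const, card_range]
  refine mul_le_mul_of_nonneg_right ?_ (by positivity)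
  rw [← prod_filter, prod_const]
  refine pow_le_pow_right₀ hR ?_
  have h2 : (range m).filter (· < K) ⊆ range K := fun i hi => by simp at hi ⊢; exact hi.2
  simpa using card_le_card h2

/-- All but boundedly many factors are below some q with 1/(1-z) < q < A, and the emergency term is
only H/n. The power of y costs n^(2d), which (q/A)^n beats. -/
theorem tendsto_courseSum_bound {x z A : ℝ} (hx : 1 < x) (hz : 0 < z) (hxz : x - 1 < 1 - z)
    (hA : 1 < A * (1 - z)) (d : ℕ) :
    Tendsto (fun n : ℕ => (∏ i ∈ range (n - 1), ((1 - z - (x - 1) / ((i + 1 : ℕ) : ℝ))⁻¹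
        + n * ((n : ℝ) ^ 2)⁻¹ * (2 - z - x)⁻¹)) / (A ^ n * (((n : ℝ) ^ 2)⁻¹) ^ d))
      atTop (𝓝 0) := by
  have hz1 : 0 < 1 - z := by linarith
  set H := (2 - z - x)⁻¹ with hH
  have hHpos : 0 < 2 - z - x := by linarith
  have hH1 : 1 ≤ H := (one_le_inv₀ hHpos).2 (by linarith)
  set g : ℕ → ℝ := fun i => (1 - z - (x - 1) / ((i + 1 : ℕ) : ℝ))⁻¹ with hg
  have hden : ∀ i : ℕ, 2 - z - x ≤ 1 - z - (x - 1) / ((i + 1 : ℕ) : ℝ) := fun i => by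
    have : (x - 1) / ((i + 1 : ℕ) : ℝ) ≤ x - 1 :=
      div_le_self (by linarith) (by push_cast; linarith [Nat.cast_nonneg (α := ℝ) i])
    linarith
  have hg0 : ∀ i, 0 ≤ g i := fun i => inv_nonneg.2 (hHpos.le.trans (hden i))
  have hgH : ∀ i, g i ≤ H := fun i => inv_anti₀ hHpos (hden i)
  have hglim : Tendsto g atTop (𝓝 (1 - z)⁻¹) := by
    have h1 : Tendsto (fun i : ℕ => (x - 1) / ((i + 1 : ℕ) : ℝ)) atTop (𝓝 0) :=
      (tendsto_const_div_atTop_nhds_zero_nat (x - 1)).comp (tendsto_add_atTop_nat 1)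
    have h2 := (tendsto_const_nhds (x := 1 - z)).sub h1
    rw [sub_zero] at h2
    exact h2.inv₀ hz1.ne'
  have hA' : (1 - z)⁻¹ < A := by rwa [inv_lt_iff_one_lt_mul₀ hz1]
  obtain ⟨q, hq1, hqA⟩ := exists_between hA'
  -- The gap between `p` and `q` absorbs H/n.
  obtain ⟨p, hp1, hpq⟩ := exists_between hq1
  have hinv1 : 1 ≤ (1 - z)⁻¹ := (one_le_inv₀ hz1).2 (by linarith)
  have hq0 : 1 ≤ q := by linarith
  have hApos : 0 < A := by linarith
  obtain ⟨K, hK⟩ := eventually_atTop.1 (hglim.eventually_lt_const hp1)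
  have hlimH : Tendsto (fun n : ℕ => H / n) atTop (𝓝 0) := tendsto_const_div_atTop_nhds_zero_nat H
  have hev := hlimH.eventually_lt_const (sub_pos.2 hpq)
  have hqA1 : |q / A| < 1 := by
    rw [abs_of_pos (by positivity), div_lt_one hApos]
    exact hqA
  have hlim := (tendsto_pow_const_mul_const_pow_of_abs_lt_one (2 * d) hqA1).const_mul
    ((2 * H) ^ K)
  rw [mul_zero] at hlim
  refine squeeze_zero' (Eventually.of_forall fun n => ?_) ?_ hlim
  · refine div_nonneg (prod_nonneg fun i _ => ?_) (by positivity)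
    have := hg0 i
    positivity
  · filter_upwards [hev, eventually_ge_atTop 1] with n hn hn1
    have hn1' : (1 : ℝ) ≤ n := by exact_mod_cast hn1
    have e : (n : ℝ) * ((n : ℝ) ^ 2)⁻¹ * H = H / n := by field_simp
    rw [e]
    have hHn : 0 ≤ H / n := by positivity
    have hHnle : H / n ≤ H := div_le_self (by linarith) hn1'
    have hprod := prod_le_const_mul_pow (g := fun i => g i + H / n) (R := 2 * H) (q := q) (K := K)
      (fun i => add_nonneg (hg0 i) hHn) (by linarith) hq0
      (fun i => by linarith [hgH i]) (fun i hi => by linarith [hK i hi]) (n - 1)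
    have hpow : q ^ (n - 1) ≤ q ^ n := pow_le_pow_right₀ hq0 (Nat.sub_le _ _)
    rw [div_le_iff₀ (by positivity)]
    calc _ ≤ (2 * H) ^ K * q ^ (n - 1) := hprod
      _ ≤ (2 * H) ^ K * q ^ n := by gcongr
      _ = _ := by
        rw [div_pow, pow_mul, inv_pow]
        field_simp

theorem tendsto_costLaw_makerCanAchieve {b : ℕ} {x z β : ℝ} (hx : 1 < x) (hz : 0 < z)
    (hxz : x - 1 < 1 - z) (hkey : 1 < x ^ β * z ^ b * (1 - z)) :
    Tendsto (fun n : ℕ => costLaw n {C : Costs n | MakerCanAchieve b C ((β + b + 1) * n)})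
      atTop (𝓝 1) := by
  have hlim := ENNReal.tendsto_ofReal
    ((tendsto_courseSum_bound hx hz hxz hkey (5 * b)).const_sub 1)
  rw [sub_zero, ENNReal.ofReal_one] at hlim
  refine tendsto_of_tendsto_of_tendsto_of_le_of_le' hlim tendsto_const_nhds ?_
    (Eventually.of_forall fun n => MeasureTheory.prob_le_one)
  filter_upwards [eventually_ge_atTop 15, eventually_gt_atTop (4 * (b * (5 * b + 1)))]
    with n hn hbn
  obtain ⟨pick, hpick_mem, hpick⟩ := exists_pick (n := n) (by omega)
  refine ENNReal.ofReal_le_of_le_toReal ?_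
  have hy : 0 ≤ ((n : ℝ) ^ 2)⁻¹ := by positivity
  refine one_sub_div_le_costLaw (f := courseSum x z ((n : ℝ) ^ 2)⁻¹ pick (n - 1) id) ?_
    (courseSum_nonneg (by linarith) hz.le hy pick _ _) ?_ ?_
  · have : (0 : ℝ) < n := by exact_mod_cast (by omega : 0 < n)
    have : 0 < x := by linarith
    positivity
  · refine sum_courseSum_le hz.le (by linarith) hx.le hxz hy hpick (n - 1) (fun _ => rfl) ?_
    simp only [roots, id_eq, filter_true, card_univ, Fintype.card_fin]
    omega
  · intro C hC
    exact makerCanAchieve_of_courseSum_le hx hz (by linarith) hn hbn hpick_mem hpick hC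

/-- A diagonal argument: convergence for every fixed `ε` gives convergence along some sequence
tending to zero. -/
theorem exists_tendsto_zero_of_forall_pos {P : ℕ → ℝ → ENNReal} (hP : ∀ n ε, P n ε ≤ 1)
    (h : ∀ ε, 0 < ε → Tendsto (fun n => P n ε) atTop (𝓝 1)) :
    ∃ δ : ℕ → ℝ, Tendsto δ atTop (𝓝 0) ∧ Tendsto (fun n => P n (δ n)) atTop (𝓝 1) := by
  classical
  set p : ℕ → ℕ → Prop := fun n m => 1 - ((m + 1 : ℕ) : ENNReal)⁻¹ ≤ P n (1 / ((m : ℝ) + 1))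
  -- At m = 0 the condition reads 0 ≤ P, so the search never falls back on an invalid default.
  set k : ℕ → ℕ := fun n => Nat.findGreatest (p n) n
  have hk : Tendsto k atTop atTop := by
    refine tendsto_atTop.2 fun M => ?_
    have hlt : 1 - ((M + 1 : ℕ) : ENNReal)⁻¹ < 1 :=
      ENNReal.sub_lt_self ENNReal.one_ne_top one_ne_zero (by simp)
    filter_upwards [(h (1 / ((M : ℝ) + 1)) (by positivity)).eventually_const_lt hlt,
      eventually_ge_atTop M] with n hn hM
    exact Nat.le_findGreatest hM hn.le
  refine ⟨fun n => 1 / ((k n : ℝ) + 1), tendsto_one_div_add_atTop_nhds_zero_nat.comp hk, ?_⟩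
  have hlow : Tendsto (fun n => 1 - ((k n + 1 : ℕ) : ENNReal)⁻¹) atTop (𝓝 1) := by
    have h1 : Tendsto (fun n => ((k n + 1 : ℕ) : ENNReal)⁻¹) atTop (𝓝 0) :=
      ENNReal.tendsto_inv_nat_nhds_zero.comp ((tendsto_add_atTop_nat 1).comp hk)
    have h2 := ENNReal.Tendsto.sub (tendsto_const_nhds (x := (1 : ENNReal))) h1
      (Or.inl ENNReal.one_ne_top)
    rwa [tsub_zero] at h2
  refine tendsto_of_tendsto_of_tendsto_of_le_of_le hlow tendsto_const_nhds (fun n => ?_)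
    fun n => hP _ _
  exact Nat.findGreatest_spec (P := p n) (Nat.zero_le n) (by simp [p])

/-- Since θ < 5/17, the exponent b/θ is at least 17b/5. At x = 17/10 and z = 1/4 the criterion then
reduces to (17/10)^(17/5) > 16/3, checked on fifth powers. The inequality is strict, so no error
term is needed. -/
theorem tendsto_costLaw_makerCanAchieve_of_pos {b : ℕ} (hb : 1 ≤ b) {θ : ℝ} (hθ : 0 < θ)
    (hθ' : θ < 0.2939) :
    Tendsto (fun n : ℕ => costLaw n {C : Costs n | MakerCanAchieve b C ((b / θ + b + 1) * n)})
      atTop (𝓝 1) := by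
  refine tendsto_costLaw_makerCanAchieve (x := 17 / 10) (z := 1 / 4) (by norm_num) (by norm_num)
    (by norm_num) ?_
  set u : ℝ := (17 / 10 : ℝ) ^ (17 / 5 : ℝ) with hu
  have hu0 : 0 ≤ u := by positivity
  have hu5 : u ^ 5 = (17 / 10) ^ 17 := by
    rw [hu, ← Real.rpow_natCast, ← Real.rpow_mul (by norm_num), ← Real.rpow_natCast]
    norm_num
  have hu1 : 16 / 3 < u := lt_of_pow_lt_pow_left₀ 5 hu0 (by rw [hu5]; norm_num)
  have hpow : u ^ b ≤ (17 / 10 : ℝ) ^ ((b : ℝ) / θ) := by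
    rw [hu, ← Real.rpow_natCast, ← Real.rpow_mul (by norm_num)]
    refine Real.rpow_le_rpow_of_exponent_le (by norm_num) ?_
    rw [le_div_iff₀ hθ]
    have : (0 : ℝ) ≤ b := Nat.cast_nonneg b
    nlinarith
  have h1 : u * (1 / 4) ≤ (u * (1 / 4)) ^ b := le_self_pow₀ (by linarith) (by omega)
  rw [mul_pow] at h1
  have h2 : u ^ b * (1 / 4) ^ b ≤ (17 / 10 : ℝ) ^ ((b : ℝ) / θ) * (1 / 4) ^ b := by gcongr
  linarith

/-- Without deletions z carries no cost in the criterion, so z near 0 and x = 3/2 reach every β = ε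
> 0. -/
theorem tendsto_costLaw_makerCanAchieve_zero {ε : ℝ} (hε : 0 < ε) :
    Tendsto (fun n : ℕ => costLaw n {C : Costs n | MakerCanAchieve 0 C ((1 + ε) * n)})
      atTop (𝓝 1) := by
  have hu : 1 < (3 / 2 : ℝ) ^ ε := Real.one_lt_rpow (by norm_num) hε
  set u := (3 / 2 : ℝ) ^ ε with hu_def
  have hinv : u⁻¹ < 1 := inv_lt_one_of_one_lt₀ hu
  obtain ⟨w, hw1, hw2⟩ := exists_between (max_lt hinv (by norm_num : (1 / 2 : ℝ) < 1))
  obtain ⟨hwu, hwh⟩ := max_lt_iff.1 hw1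
  have h := tendsto_costLaw_makerCanAchieve (b := 0) (x := 3 / 2) (z := 1 - w) (β := ε)
    (by norm_num) (by linarith) (by linarith) (by
      rw [pow_zero, mul_one, ← hu_def, sub_sub_cancel]
      exact (inv_lt_iff_one_lt_mul₀' (by linarith)).1 hwu)
  simpa [add_comm] using h

/-! ### Existence, uniqueness and location of θ*. -/

/-- The function whose value at `θ*` is `log 2`. -/
noncomputable def entropyGap (t : ℝ) : ℝ := (1 + t) * Real.log (1 + t) - t * Real.log t

theorem continuous_entropyGap : Continuous entropyGap :=
  (Real.continuous_mul_log.comp (continuous_const.add continuous_id)).sub Real.continuous_mul_log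

theorem strictMonoOn_entropyGap : StrictMonoOn entropyGap (Set.Ici 0) := by
  refine strictMonoOn_of_deriv_pos (convex_Ici 0) continuous_entropyGap.continuousOn fun t ht => ?_
  rw [interior_Ici, Set.mem_Ioi] at ht
  have h1 : HasDerivAt (fun t : ℝ => (1 + t) * Real.log (1 + t)) (Real.log (1 + t) + 1) t := by
    exact (Real.hasDerivAt_mul_log (x := 1 + t) (by linarith)).comp_const_add 1 t
  have h2 : HasDerivAt entropyGap _ t := h1.sub (Real.hasDerivAt_mul_log ht.ne')
  rw [h2.deriv]
  have := Real.log_lt_log ht (by linarith : t < 1 + t)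
  linarith

set_option exponentiation.threshold 20000 in
-- Multiplying by the denominator 5000 and exponentiating leaves a comparison of integers; the upper
-- bound works likewise with 10000.
theorem entropyGap_lower : entropyGap 0.2938 ≤ Real.log 2 := by
  have hN : 6469 ^ 6469 ≤ 2 ^ 5000 * 1469 ^ 1469 * 5000 ^ 5000 := by norm_num
  have hR : (6469 : ℝ) ^ 6469 ≤ 2 ^ 5000 * 1469 ^ 1469 * 5000 ^ 5000 := by exact_mod_cast hN
  have hlog := Real.log_le_log (by positivity) hR
  rw [Real.log_mul (by positivity) (by positivity), Real.log_mul (by positivity) (by positivity),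
    Real.log_pow, Real.log_pow, Real.log_pow, Real.log_pow] at hlog
  have e1 : (1 + 0.2938 : ℝ) = 6469 / 5000 := by norm_num
  have e2 : (0.2938 : ℝ) = 1469 / 5000 := by norm_num
  rw [entropyGap, e1, e2, Real.log_div (by norm_num) (by norm_num),
    Real.log_div (by norm_num) (by norm_num)]
  push_cast at hlog
  linarith

set_option exponentiation.threshold 20000 in
theorem entropyGap_upper : Real.log 2 < entropyGap 0.2939 := by
  have hN : 2 ^ 10000 * 2939 ^ 2939 * 10000 ^ 10000 < 12939 ^ 12939 := by norm_num
  have hR : (2 : ℝ) ^ 10000 * 2939 ^ 2939 * 10000 ^ 10000 < 12939 ^ 12939 := by exact_mod_cast hN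
  have hlog := Real.log_lt_log (by positivity) hR
  rw [Real.log_mul (by positivity) (by positivity), Real.log_mul (by positivity) (by positivity),
    Real.log_pow, Real.log_pow, Real.log_pow, Real.log_pow] at hlog
  have e1 : (1 + 0.2939 : ℝ) = 12939 / 10000 := by norm_num
  have e2 : (0.2939 : ℝ) = 2939 / 10000 := by norm_num
  rw [entropyGap, e1, e2, Real.log_div (by norm_num) (by norm_num),
    Real.log_div (by norm_num) (by norm_num)]
  push_cast at hlog
  linarith

theorem exists_entropyGap_eq : ∃ θ : ℝ, 0.2938 ≤ θ ∧ θ < 0.2939 ∧ entropyGap θ = Real.log 2 := by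
  obtain ⟨θ, ⟨h1, h2⟩, h3⟩ := intermediate_value_Icc (by norm_num : (0.2938 : ℝ) ≤ 0.2939)
    continuous_entropyGap.continuousOn ⟨entropyGap_lower, entropyGap_upper.le⟩
  refine ⟨θ, h1, lt_of_le_of_ne h2 fun h => ?_, h3⟩
  rw [h] at h3
  exact entropyGap_upper.ne h3.symm

end WeightedTreeGame

theorem theorem3 :
    ∃ θ : ℝ, 0 < θ ∧
      (1 + θ) * Real.log (1 + θ) - θ * Real.log θ = Real.log 2 ∧
      (∀ x : ℝ, 0 < x → (1 + x) * Real.log (1 + x) - x * Real.log x = Real.log 2 → x = θ) ∧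
      0.2938 ≤ θ ∧ θ < 0.2939 ∧
      ∀ b : ℕ, ∃ δ : ℕ → ℝ, Filter.Tendsto δ Filter.atTop (nhds 0) ∧
        Filter.Tendsto
          (fun n : ℕ => WeightedTreeGame.costLaw n
            {C : WeightedTreeGame.Costs n |
              WeightedTreeGame.MakerCanAchieve b C (((b : ℝ) / θ + b + 1 + δ n) * n)})
          Filter.atTop (nhds 1) := by
  obtain ⟨θ, hθ1, hθ2, hθ⟩ := WeightedTreeGame.exists_entropyGap_eq
  have hpos : 0 < θ := lt_of_lt_of_le (by norm_num) hθ1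
  refine ⟨θ, hpos, hθ, fun x hx hxeq => ?_, hθ1, hθ2, fun b => ?_⟩
  · exact WeightedTreeGame.strictMonoOn_entropyGap.injOn hx.le hpos.le (hxeq.trans hθ.symm)
  · rcases Nat.eq_zero_or_pos b with rfl | hb
    · refine WeightedTreeGame.exists_tendsto_zero_of_forall_pos
        (P := fun n ε => WeightedTreeGame.costLaw n
          {C : WeightedTreeGame.Costs n | WeightedTreeGame.MakerCanAchieve 0 C
            ((((0 : ℕ) : ℝ) / θ + ((0 : ℕ) : ℝ) + 1 + ε) * n)})
        (fun n ε => MeasureTheory.prob_le_one) fun ε hε => ?_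
      simpa using WeightedTreeGame.tendsto_costLaw_makerCanAchieve_zero hε
    · refine ⟨fun _ => 0, tendsto_const_nhds, ?_⟩
      simpa using WeightedTreeGame.tendsto_costLaw_makerCanAchieve_of_pos hb hpos hθ2
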